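/- Let $G$ be a connected real semisimple Lie group with Lie algebra $L$, and let $L = L_K \oplus L_P$ be a Cartan decomposition: $L_K$ is a subalgebra, $L_P$ is a subspace, the Killing form is negative definite on $L_K$ and positive definite on $L_P$, and $L_K$ and $L_P$ are Killing-orthogonal. Let $K \subseteq G$ be the connected subgroup generated by $\exp(L_K)$, let $P = G/K$, and let $\pi_K : G \to P$ be the projection. Let $\rho : G \to \mathrm{SL}(d,\mathbb{C})$ be a smooth representation which is faithful on $L$ and consistent with the polar decomposition, i.e. (writing $\rho$ also for its derivative) $\rho(z)$ is skew-Hermitian for $z \in L_K$ and $\rho(y)$ is Hermitian for $y \in L_P$. Thus, for $x = y + z$ with $y \in L_P$ and $z \in L_K$, $$\langle x,x\rangle_+ = \operatorname{tr}\rho(x)\rho(x)^* = \langle y,y\rangle_P + \langle z,z\rangle_K, \qquad \langle x,x\rangle_- = \operatorname{Re}\operatorname{tr}\rho(x)^2 = \langle y,y\rangle_P - \langle z,z\rangle_K,$$ where $\langle y,y\rangle_P = \operatorname{tr}\rho(y)\rho(y)^*$ and $\langle z,z\rangle_K = \operatorname{tr}\rho(z)\rho(z)^*$. Give $G$ the distance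 of the left-invariant Riemannian metric induced by $\langle\cdot,\cdot\rangle_+$. Give $P \times K$ the distance of the product Riemannian metric, where $P = G/K$ has the $G$-invariant Riemannian metric induced by $\langle\cdot,\cdot\rangle_P$ on $L_P \cong T_{1K}(G/K)$ and $K$ has the bi-invariant Riemannian metric induced by $\langle\cdot,\cdot\rangle_K$ on $L_K$. Let $\mu : P \to G$ be a smooth embedding with $\pi_K \circ \mu = \mathrm{id}_P$, and suppose that $\mu(P)$ is non-timelike for the bi-invariant pseudo-Riemannian metric on $G$ induced by $\langle\cdot,\cdot\rangle_-$, i.e. $\langle x,x\rangle_- \ge 0$ for every vector $x$ tangent to $\mu(P)$. Then the map $P \times K \to G$, $(p,k) \mapsto \mu(p)k$, is a bijection and a bi-Lipschitz equivalence. More precisely, both this map and its inverse are $\varphi$-Lipschitz, where $\varphi = (1+\sqrt5)/2$. -/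

import Mathlib

open scoped Manifold ContDiff ENNReal Matrix

noncomputable section

namespace CartanBilip

instance instLEInftyMinSmoothness : ENat.LEInfty (minSmoothness ℝ 3) where
  out := by
    rw [minSmoothness_of_isRCLikeNormedField]
    exact ENat.LEInfty.out

section Defs

variable {E : Type*} [NormedAddCommGroup E] [NormedSpace ℝ E]
  {H : Type*} [TopologicalSpace H] {I : ModelWithCorners ℝ E H}
  {G : Type*} [TopologicalSpace G] [ChartedSpace H G] [Group G]

/-- A Cartan decomposition `L = L_K ⊕ L_P` of the Lie algebra `L` of `G`: the Killing form is
positive definite on the subspace `L_P` and negative definite on the subalgebra `L_K`, and the two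
are Killing-orthogonal. -/
structure IsCartanDecomposition [CompleteSpace E] [LieGroup I (minSmoothness ℝ 3) G]
    (LK : LieSubalgebra ℝ (GroupLieAlgebra I G)) (LP : Submodule ℝ (GroupLieAlgebra I G)) :
    Prop where
  isCompl : IsCompl LP LK.toSubmodule
  killing_pos : ∀ y ∈ LP, y ≠ 0 → 0 < killingForm ℝ (GroupLieAlgebra I G) y y
  killing_neg : ∀ z ∈ LK, z ≠ 0 → killingForm ℝ (GroupLieAlgebra I G) z z < 0
  killing_orthogonal : ∀ y ∈ LP, ∀ z ∈ LK, killingForm ℝ (GroupLieAlgebra I G) y z = 0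

/-- `g = exp x`: the integral curve through `1` of the left-invariant vector field of `x`
is at `g` at time `1`. -/
def IsExp (x : GroupLieAlgebra I G) (g : G) : Prop :=
  ∃ γ : ℝ → G, γ 0 = 1 ∧ IsMIntegralCurve γ (mulInvariantVectorField (I := I) x) ∧ γ 1 = g

/-- The connected subgroup of `G` with Lie algebra `L_K`: the subgroup generated by
`exp z` for `z ∈ L_K`. -/
def angularSubgroup (LK : Submodule ℝ (GroupLieAlgebra I G)) : Subgroup G :=
  Subgroup.closure {g : G | ∃ z ∈ LK, IsExp z g}

variable (I) in
/-- Left trivialization `T_gG → L`, `v ↦ g⁻¹ v`. -/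
def leftTriv (g : G) (v : TangentSpace I g) : GroupLieAlgebra I G :=
  (mfderiv I I (fun h : G => g⁻¹ * h) g v : E)

variable (I) in
/-- The left-trivialized velocity `γ(t)⁻¹ γ'(t) ∈ L` of a path `γ : [0,1] → G`. -/
def leftVelocity (γ : ℝ → G) (t : ℝ) : GroupLieAlgebra I G :=
  leftTriv I (γ t) (mfderivWithin 𝓘(ℝ, ℝ) I γ (Set.Icc 0 1) t (1 : ℝ))

variable {d : ℕ}

variable (I) in
/-- The derivative at `1` of a representation `ρ : G → SL(d, ℂ)`, computed entrywise. -/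
def dRep (ρ : G →* Matrix.SpecialLinearGroup (Fin d) ℂ) (x : GroupLieAlgebra I G) :
    Matrix (Fin d) (Fin d) ℂ :=
  Matrix.of fun i j =>
    (mfderiv I 𝓘(ℝ, ℂ) (fun g : G => (ρ g : Matrix (Fin d) (Fin d) ℂ) i j) 1 x : ℂ)

/-- A smooth representation `ρ : G → SL(d, ℂ)` that is faithful on the Lie algebra and in which
the Cartan decomposition of `G` is consistent with the polar decomposition of `SL(d, ℂ)`:
`ρ` is skew-Hermitian on `L_K` and Hermitian on `L_P`. -/
structure IsAdaptedRep (ρ : G →* Matrix.SpecialLinearGroup (Fin d) ℂ)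
    (LK LP : Submodule ℝ (GroupLieAlgebra I G)) : Prop where
  smooth : ∀ i j, ContMDiff I 𝓘(ℝ, ℂ) ∞ (fun g : G => (ρ g : Matrix (Fin d) (Fin d) ℂ) i j)
  faithful : Function.Injective (dRep I ρ)
  skewHermitian : ∀ z ∈ LK, (dRep I ρ z)ᴴ = -dRep I ρ z
  hermitian : ∀ y ∈ LP, (dRep I ρ y)ᴴ = dRep I ρ y

variable (I) in
/-- The positive definite form `⟨x,x⟩₊ = tr ρ(x) ρ(x)*` on `L`. -/
def plusForm (ρ : G →* Matrix.SpecialLinearGroup (Fin d) ℂ) (x : GroupLieAlgebra I G) : ℝ :=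
  (Matrix.trace (dRep I ρ x * (dRep I ρ x)ᴴ)).re

variable (I) in
/-- The indefinite form `⟨x,x⟩₋ = Re tr ρ(x)²` on `L`. -/
def minusForm (ρ : G →* Matrix.SpecialLinearGroup (Fin d) ℂ) (x : GroupLieAlgebra I G) : ℝ :=
  (Matrix.trace (dRep I ρ x * dRep I ρ x)).re

variable (I) in
/-- The distance on `G` of the left-invariant Riemannian metric given by `⟨·,·⟩₊` on `L`. -/
def distG (ρ : G →* Matrix.SpecialLinearGroup (Fin d) ℂ) (g h : G) : ℝ≥0∞ :=
  letI : ∀ x : G, ENorm (TangentSpace I x) :=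
    fun x => ⟨fun v => ENNReal.ofReal √(plusForm I ρ (leftTriv I x v))⟩
  Manifold.riemannianEDist I g h

/-- The distance of the product Riemannian metric on `P × K`, where `P = G/K` carries the
`G`-invariant metric given by `⟨·,·⟩₊` on `L_P ≅ T_{1·K}(G/K)`, and `K` the bi-invariant metric
given by `⟨·,·⟩₊` on `L_K`. It is the infimum of the lengths of `C¹` paths in `G/K × K`.

A `C¹` path in `G/K` is the projection of a `C¹` path `α` in `G`, and its velocity, which is the
image of `α'` in `T(G/K)`, is carried by the action of `α⁻¹` to the image of `α⁻¹α'` in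
`L/L_K ≅ L_P`, that is, to the `L_P`-component of `α⁻¹α'`. The norm of that component
does not depend on the lift `α`, as `⟨·,·⟩₊` is invariant under `Ad K`. -/
def distPK (ρ : G →* Matrix.SpecialLinearGroup (Fin d) ℂ)
    {LK LP : Submodule ℝ (GroupLieAlgebra I G)} (hc : IsCompl LP LK)
    (a b : (G ⧸ angularSubgroup LK) × angularSubgroup LK) : ℝ≥0∞ :=
  ⨅ (α : ℝ → G) (β : ℝ → G)
    (_ : ContMDiffOn 𝓘(ℝ, ℝ) I 1 α (Set.Icc 0 1))
    (_ : ContMDiffOn 𝓘(ℝ, ℝ) I 1 β (Set.Icc 0 1))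
    (_ : ∀ t ∈ Set.Icc (0 : ℝ) 1, β t ∈ angularSubgroup LK)
    (_ : ((α 0 : G) : G ⧸ angularSubgroup LK) = a.1 ∧ β 0 = a.2)
    (_ : ((α 1 : G) : G ⧸ angularSubgroup LK) = b.1 ∧ β 1 = b.2),
    ∫⁻ t in Set.Icc (0 : ℝ) 1, ENNReal.ofReal
      √(plusForm I ρ (LP.projection LK hc (leftVelocity I α t)) + plusForm I ρ (leftVelocity I β t))

/-- A smooth section `μ` of `G → G/K`. Smoothness is with respect to the quotient manifold
structure, for which the projection is a surjective submersion, so that a map out of `G/K` is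
smooth if and only if its composition with the projection is. -/
structure IsSmoothSection (K : Subgroup G) (I : ModelWithCorners ℝ E H) (μ : G ⧸ K → G) :
    Prop where
  section_eq : ∀ p : G ⧸ K, ((μ p : G) : G ⧸ K) = p
  smooth : ContMDiff I I ∞ (fun g : G => μ (g : G ⧸ K))

/-- The image of a smooth map `μ : G/K → G` is non-timelike for the left-invariant
pseudo-Riemannian metric given by `⟨·,·⟩₋` on `L`. As the projection `G → G/K` is a submersion,
the vectors tangent to `μ` are those of the form `D(μ ∘ π)(v)`, for `v` tangent to `G`. -/
def IsNonTimelike (ρ : G →* Matrix.SpecialLinearGroup (Fin d) ℂ) (K : Subgroup G)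
    (I : ModelWithCorners ℝ E H) (μ : G ⧸ K → G) : Prop :=
  ∀ (g : G) (v : TangentSpace I g),
    0 ≤ minusForm I ρ (leftTriv I (μ (g : G ⧸ K))
      (mfderiv I I (fun h : G => μ (h : G ⧸ K)) g v))

end Defs

end CartanBilip

end

/-!
The map `(p, k) ↦ μ(p) k` is a bijection because `μ` is a section. The two Lipschitz bounds follow
from a comparison of speeds of `C¹` paths, carried out in the matrix algebra: `dρ` of the
left-trivialized velocity of a path `γ` is `M⁻¹ M'` with `M = ρ ∘ γ`
(`hasDerivWithinAt_rep_entry`), so velocities of products of paths obey the Leibniz rule for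
matrices (`dRep_leftVelocity_mul`). Under `dρ` the decomposition `L = L_P ⊕ L_K` becomes the
decomposition of a matrix into its Hermitian and skew-Hermitian parts, which are orthogonal for the
Frobenius inner product; `⟨·,·⟩₊` and `⟨·,·⟩₋` are the sum and the difference of the squared
Frobenius norms of the two parts.

The group `K` acts by unitary matrices (`IsAdaptedRep.rep_mul_conjTranspose`). This has two
consequences. Conjugation by `K` preserves the Hermitian part, the skew-Hermitian part and their
norms. Moreover, the velocity of a `C¹` path in `K` is skew-Hermitian
(`IsAdaptedRep.conjTranspose_dRep_leftVelocity`), so that no theory of integral subgroups is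
needed to see that it has no `L_P`-component.

A path `γ` in `G` is written as `γ = σ β`, where `σ = μ(γK)` runs on the section and `β` runs in
`K`; conversely, a path `(αK, β)` in `G/K × K` gives `γ = σ β` with `σ = μ(αK)`. Since `σ` and `α`
differ by a path in `K`, the Hermitian parts of their velocities have the same norm `A`, which is
also the norm of the Hermitian part of the velocity of `γ`. Let `C` be the norm of the velocity of
`β`, and `D` that of the skew-Hermitian part of the velocity of `γ`. As `σ` is non-timelike, the
skew-Hermitian part of its velocity has norm at most `A`, hence `|C - D| ≤ A`. The speed in
`G/K × K` is `√(A² + C²)`, the speed in `G` is `√(A² + D²)`, and `A² + (A + C)² ≤ φ² (A² + C²)`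
shows that each is at most `φ` times the other (`velocity_estimate`).
-/

namespace CartanBilip

/-! ### Matrix estimates -/

section MatrixEstimates
variable {d : ℕ}

open scoped Matrix.Norms.Frobenius

theorem re_trace_mul_conjTranspose_eq_norm_sq (X : Matrix (Fin d) (Fin d) ℂ) :
    (Matrix.trace (X * Xᴴ)).re = ‖X‖ ^ 2 := by
  rw [Matrix.frobenius_norm_def, ← Real.sqrt_eq_rpow, Real.sq_sqrt (by positivity)]
  simp [Matrix.trace, Matrix.mul_apply, Complex.mul_conj, Complex.normSq_eq_norm_sq]
  norm_cast

theorem re_trace_mul_eq_zero_of_hermitian_skewHermitian {h s : Matrix (Fin d) (Fin d) ℂ}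
    (hh : hᴴ = h) (hs : sᴴ = -s) : (Matrix.trace (h * s)).re = 0 := by
  have key : star (Matrix.trace (h * s)) = -Matrix.trace (h * s) := by
    rw [← Matrix.trace_conjTranspose, Matrix.conjTranspose_mul, hh, hs, Matrix.neg_mul,
      Matrix.trace_neg, Matrix.trace_mul_comm]
  have := congrArg Complex.re key
  simp only [Complex.star_def, Complex.conj_re, Complex.neg_re] at this
  linarith

theorem re_trace_mul_conjTranspose_add {h s : Matrix (Fin d) (Fin d) ℂ}
    (hh : hᴴ = h) (hs : sᴴ = -s) :
    (Matrix.trace ((h + s) * (h + s)ᴴ)).re = ‖h‖ ^ 2 + ‖s‖ ^ 2 := by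
  have h0 := re_trace_mul_eq_zero_of_hermitian_skewHermitian hh hs
  rw [← re_trace_mul_conjTranspose_eq_norm_sq h, ← re_trace_mul_conjTranspose_eq_norm_sq s,
    Matrix.conjTranspose_add, hh, hs]
  simp only [mul_add, add_mul, mul_neg, Matrix.trace_add, Matrix.trace_neg, Complex.add_re,
    Complex.neg_re, Matrix.trace_mul_comm s h, h0]
  ring

theorem re_trace_sq_add {h s : Matrix (Fin d) (Fin d) ℂ} (hh : hᴴ = h) (hs : sᴴ = -s) :
    (Matrix.trace ((h + s) * (h + s))).re = ‖h‖ ^ 2 - ‖s‖ ^ 2 := by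
  have h0 := re_trace_mul_eq_zero_of_hermitian_skewHermitian hh hs
  rw [← re_trace_mul_conjTranspose_eq_norm_sq h, ← re_trace_mul_conjTranspose_eq_norm_sq s,
    hh, hs]
  simp only [mul_add, add_mul, mul_neg, Matrix.trace_add, Matrix.trace_neg, Complex.add_re,
    Complex.neg_re, Matrix.trace_mul_comm s h, h0]
  ring

theorem norm_conjTranspose_mul_mul_of_unitary {U : Matrix (Fin d) (Fin d) ℂ} (hU : U * Uᴴ = 1)
    (X : Matrix (Fin d) (Fin d) ℂ) : ‖Uᴴ * X * U‖ = ‖X‖ := by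
  rw [← sq_eq_sq₀ (norm_nonneg _) (norm_nonneg _), ← re_trace_mul_conjTranspose_eq_norm_sq,
    ← re_trace_mul_conjTranspose_eq_norm_sq, Matrix.conjTranspose_mul, Matrix.conjTranspose_mul,
    Matrix.conjTranspose_conjTranspose]
  have : Uᴴ * X * U * (Uᴴ * (Xᴴ * U)) = Uᴴ * (X * Xᴴ * U) := by
    calc _ = Uᴴ * X * (U * Uᴴ) * (Xᴴ * U) := by simp only [mul_assoc]
      _ = _ := by rw [hU]; simp only [mul_one, mul_assoc]
  rw [this, Matrix.trace_mul_comm, mul_assoc, hU, mul_one]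

/-- The largest eigenvalue of the quadratic form `A² + (A + C)²` is `φ²`. -/
theorem add_sq_le_goldenRatio_sq_mul {A C D : ℝ} (hD : 0 ≤ D)
    (h : D ≤ A + C) :
    A ^ 2 + D ^ 2 ≤ Real.goldenRatio ^ 2 * (A ^ 2 + C ^ 2) := by
  have h1 : D ^ 2 ≤ (A + C) ^ 2 := pow_le_pow_left₀ hD h 2
  have hφ := Real.goldenRatio_sq
  have hpos := Real.goldenRatio_pos
  -- `φ² (A² + C²) - A² - (A + C)² = φ ((φ - 1) A - C)²`
  have h3 : 0 ≤ Real.goldenRatio * ((Real.goldenRatio - 1) * A - C) ^ 2 := by positivity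
  have h4 : Real.goldenRatio * ((Real.goldenRatio - 1) * A - C) ^ 2
      = (Real.goldenRatio - 1) * A ^ 2 - 2 * A * C + Real.goldenRatio * C ^ 2 := by
    linear_combination (A ^ 2 * (Real.goldenRatio - 1) - 2 * A * C) * hφ
  rw [hφ]
  nlinarith

/-- The pointwise estimate behind the theorem. Let `h + w` be the velocity of a curve on the
section, `b` the velocity of a curve in `K`, and `B` the unitary matrix of a point of `K`, so that
`Bᴴ (h + w) B + b` is the velocity of the product of the curves. When `h + w` is non-timelike, the
norms of this velocity and of the pair `(h, b)` differ at most by the factor `φ`. -/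
theorem velocity_estimate {h w b B : Matrix (Fin d) (Fin d) ℂ}
    (hB : B * Bᴴ = 1) (hh : hᴴ = h) (hw : wᴴ = -w) (hb : bᴴ = -b)
    (hs : 0 ≤ (Matrix.trace ((h + w) * (h + w))).re) :
    (Matrix.trace ((Bᴴ * (h + w) * B + b) * (Bᴴ * (h + w) * B + b)ᴴ)).re
        ≤ Real.goldenRatio ^ 2 *
          ((Matrix.trace (h * hᴴ)).re + (Matrix.trace (b * bᴴ)).re) ∧
      (Matrix.trace (h * hᴴ)).re + (Matrix.trace (b * bᴴ)).re
        ≤ Real.goldenRatio ^ 2 *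
          (Matrix.trace ((Bᴴ * (h + w) * B + b) * (Bᴴ * (h + w) * B + b)ᴴ)).re := by
  have e : Bᴴ * (h + w) * B + b = Bᴴ * h * B + (Bᴴ * w * B + b) := by
    rw [mul_add, add_mul, add_assoc]
  have e1 : (Bᴴ * h * B)ᴴ = Bᴴ * h * B := by
    simp [Matrix.conjTranspose_mul, hh, mul_assoc]
  have e2 : (Bᴴ * w * B + b)ᴴ = -(Bᴴ * w * B + b) := by
    simp [Matrix.conjTranspose_mul, hw, hb, mul_assoc, add_comm]
  rw [re_trace_sq_add hh hw, sub_nonneg] at hs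
  have hwh : ‖w‖ ≤ ‖h‖ := (sq_le_sq₀ (norm_nonneg _) (norm_nonneg _)).1 hs
  rw [e, re_trace_mul_conjTranspose_add e1 e2, re_trace_mul_conjTranspose_eq_norm_sq h,
    re_trace_mul_conjTranspose_eq_norm_sq b, norm_conjTranspose_mul_mul_of_unitary hB]
  have hn := norm_conjTranspose_mul_mul_of_unitary hB w
  have t1 := norm_add_le (Bᴴ * w * B) b
  have t2 := norm_sub_le (Bᴴ * w * B + b) (Bᴴ * w * B)
  rw [add_sub_cancel_left] at t2
  constructor <;>
  exact add_sq_le_goldenRatio_sq_mul (norm_nonneg _) (by linarith)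

end MatrixEstimates

/-! ### The derivative of the representation along paths -/

section Representation

theorem coe_rep_mul {G : Type*} [Group G] {d : ℕ} {ρ : G →* Matrix.SpecialLinearGroup (Fin d) ℂ}
    (g h : G) : (ρ (g * h) : Matrix (Fin d) (Fin d) ℂ) = ρ g * ρ h := by
  rw [map_mul, Matrix.SpecialLinearGroup.coe_mul]

theorem coe_rep_inv_mul {G : Type*} [Group G] {d : ℕ}
    {ρ : G →* Matrix.SpecialLinearGroup (Fin d) ℂ} (g : G) :
    (ρ g⁻¹ : Matrix (Fin d) (Fin d) ℂ) * ρ g = 1 := by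
  rw [← coe_rep_mul, inv_mul_cancel, map_one, Matrix.SpecialLinearGroup.coe_one]

variable {E : Type*} [NormedAddCommGroup E] [NormedSpace ℝ E]
  {G : Type*} [TopologicalSpace G] [ChartedSpace E G] [Group G]
  {d : ℕ} {ρ : G →* Matrix.SpecialLinearGroup (Fin d) ℂ}

theorem dRep_add (x y : GroupLieAlgebra 𝓘(ℝ, E) G) :
    dRep 𝓘(ℝ, E) ρ (x + y) = dRep 𝓘(ℝ, E) ρ x + dRep 𝓘(ℝ, E) ρ y := by
  ext i j
  exact (mfderiv 𝓘(ℝ, E) 𝓘(ℝ, ℂ) (fun g : G => (ρ g : Matrix (Fin d) (Fin d) ℂ) i j) 1).map_add x y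

theorem hasMFDerivAt_const_mul {M : Type*} [TopologicalSpace M] [ChartedSpace E M]
    {f : M → ℂ} {z : M} {f' : TangentSpace 𝓘(ℝ, E) z →L[ℝ] ℂ}
    (hf : HasMFDerivAt 𝓘(ℝ, E) 𝓘(ℝ, ℂ) f z f') (a : ℂ) :
    HasMFDerivAt 𝓘(ℝ, E) 𝓘(ℝ, ℂ) (fun x => a * f x) z
      ((ContinuousLinearMap.mul ℝ ℂ a).comp f' : TangentSpace 𝓘(ℝ, E) z →L[ℝ] ℂ) :=
  HasMFDerivAt.comp z (ContinuousLinearMap.mul ℝ ℂ a).hasMFDerivAt hf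

variable [LieGroup 𝓘(ℝ, E) ∞ G]

/-- The derivative of a smooth representation at any point, in terms of its derivative at `1` and
the left trivialization: `dρ(v) = ρ(g) dρ(g⁻¹ v)`. -/
theorem mfderiv_rep_entry
    (hρ : ∀ i j, ContMDiff 𝓘(ℝ, E) 𝓘(ℝ, ℂ) ∞ (fun g : G => (ρ g : Matrix (Fin d) (Fin d) ℂ) i j))
    (g : G) (v : TangentSpace 𝓘(ℝ, E) g) (i j : Fin d) :
    (mfderiv 𝓘(ℝ, E) 𝓘(ℝ, ℂ) (fun g : G => (ρ g : Matrix (Fin d) (Fin d) ℂ) i j) g v : ℂ)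
      = ((ρ g : Matrix (Fin d) (Fin d) ℂ) * dRep 𝓘(ℝ, E) ρ (leftTriv 𝓘(ℝ, E) g v)) i j := by
  have hfun : (fun h : G => (ρ h : Matrix (Fin d) (Fin d) ℂ) i j) =
      ∑ k, fun h => (ρ g : Matrix (Fin d) (Fin d) ℂ) i k *
        ((fun h : G => (ρ h : Matrix (Fin d) (Fin d) ℂ) k j) ∘ fun h : G => g⁻¹ * h) h := by
    ext h
    conv_lhs => rw [← mul_inv_cancel_left g h, coe_rep_mul, Matrix.mul_apply]
    simp only [Finset.sum_apply, Function.comp_apply]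
  have hleft : HasMFDerivAt 𝓘(ℝ, E) 𝓘(ℝ, E) (fun h : G => g⁻¹ * h) g
      (mfderiv 𝓘(ℝ, E) 𝓘(ℝ, E) (fun h : G => g⁻¹ * h) g) :=
    ((contMDiff_mul_left (I := 𝓘(ℝ, E)) (n := ∞) (a := g⁻¹)).mdifferentiable
      (by simp) g).hasMFDerivAt
  have hk : ∀ k, HasMFDerivAt 𝓘(ℝ, E) 𝓘(ℝ, ℂ)
      ((fun h : G => (ρ h : Matrix (Fin d) (Fin d) ℂ) k j) ∘ fun h : G => g⁻¹ * h) g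
      ((mfderiv 𝓘(ℝ, E) 𝓘(ℝ, ℂ) (fun h : G => (ρ h : Matrix (Fin d) (Fin d) ℂ) k j)
        (g⁻¹ * g)).comp (mfderiv 𝓘(ℝ, E) 𝓘(ℝ, E) (fun h : G => g⁻¹ * h) g)) := fun k =>
    HasMFDerivAt.comp g (((hρ k j).mdifferentiable (by simp) (g⁻¹ * g)).hasMFDerivAt) hleft
  have hsum := HasMFDerivAt.sum (t := Finset.univ) fun k _ =>
    hasMFDerivAt_const_mul (hk k) ((ρ g : Matrix (Fin d) (Fin d) ℂ) i k)
  rw [← hfun] at hsum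
  -- the base point `g⁻¹ * g` of the derivative is only propositionally equal to `1`
  have base : ∀ (p : G) (_ : p = 1) (k : Fin d) (w : E),
      (mfderiv 𝓘(ℝ, E) 𝓘(ℝ, ℂ) (fun h : G => (ρ h : Matrix (Fin d) (Fin d) ℂ) k j) p w : ℂ)
        = dRep 𝓘(ℝ, E) ρ w k j := by
    rintro p rfl k w
    rfl
  rw [hsum.mfderiv, Matrix.mul_apply]
  refine (sum_apply (F := E →L[ℝ] ℂ) _ _ v).trans ?_
  refine Finset.sum_congr rfl fun k _ => ?_
  exact congrArg (fun c : ℂ => (ρ g : Matrix (Fin d) (Fin d) ℂ) i k * c) (base _ (inv_mul_cancel g) k _)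

/-- For a `C¹` path `γ`, the matrix `dρ(γ⁻¹ γ')` is the logarithmic derivative of `ρ ∘ γ`:
`(ρ ∘ γ)' = ρ(γ) dρ(γ⁻¹ γ')`, stated entrywise so that no norm on matrices has to be chosen. -/
theorem hasDerivWithinAt_rep_entry
    (hρ : ∀ i j, ContMDiff 𝓘(ℝ, E) 𝓘(ℝ, ℂ) ∞ (fun g : G => (ρ g : Matrix (Fin d) (Fin d) ℂ) i j))
    {γ : ℝ → G} (hγ : ContMDiffOn 𝓘(ℝ, ℝ) 𝓘(ℝ, E) 1 γ (Set.Icc 0 1)) {t : ℝ}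
    (ht : t ∈ Set.Icc (0 : ℝ) 1) (i j : Fin d) :
    HasDerivWithinAt (fun t => (ρ (γ t) : Matrix (Fin d) (Fin d) ℂ) i j)
      (((ρ (γ t) : Matrix (Fin d) (Fin d) ℂ) * dRep 𝓘(ℝ, E) ρ (leftVelocity 𝓘(ℝ, E) γ t)) i j)
      (Set.Icc 0 1) t := by
  have h1 := (hγ.mdifferentiableOn (by simp) t ht).hasMFDerivWithinAt
  have h2 := (((hρ i j).mdifferentiable (by simp) (γ t)).hasMFDerivAt).comp_hasMFDerivWithinAt t h1
  have h3 := (hasMFDerivWithinAt_iff_hasFDerivWithinAt (𝕜 := ℝ) (E := ℝ) (E' := ℂ)).1 h2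
  have h4 := (hasFDerivWithinAt_iff_hasDerivWithinAt (𝕜 := ℝ) (F := ℂ)).1 h3
  exact h4.congr_deriv (mfderiv_rep_entry hρ _ _ i j)

/-- The Leibniz rule for the left-trivialized velocity of a product of paths, read off in the
representation: `(σβ)⁻¹ (σβ)' = β⁻¹ (σ⁻¹ σ') β + β⁻¹ β'`. -/
theorem dRep_leftVelocity_mul
    (hρ : ∀ i j, ContMDiff 𝓘(ℝ, E) 𝓘(ℝ, ℂ) ∞ (fun g : G => (ρ g : Matrix (Fin d) (Fin d) ℂ) i j))
    {σ β γ : ℝ → G} (hσ : ContMDiffOn 𝓘(ℝ, ℝ) 𝓘(ℝ, E) 1 σ (Set.Icc 0 1))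
    (hβ : ContMDiffOn 𝓘(ℝ, ℝ) 𝓘(ℝ, E) 1 β (Set.Icc 0 1))
    (hγ : ContMDiffOn 𝓘(ℝ, ℝ) 𝓘(ℝ, E) 1 γ (Set.Icc 0 1)) (h : ∀ t, γ t = σ t * β t) {t : ℝ}
    (ht : t ∈ Set.Icc (0 : ℝ) 1) :
    dRep 𝓘(ℝ, E) ρ (leftVelocity 𝓘(ℝ, E) γ t) =
      (ρ (β t)⁻¹ : Matrix (Fin d) (Fin d) ℂ) * dRep 𝓘(ℝ, E) ρ (leftVelocity 𝓘(ℝ, E) σ t) * ρ (β t)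
        + dRep 𝓘(ℝ, E) ρ (leftVelocity 𝓘(ℝ, E) β t) := by
  have hu : UniqueDiffWithinAt ℝ (Set.Icc (0 : ℝ) 1) t := uniqueDiffOn_Icc zero_lt_one t ht
  set s := dRep 𝓘(ℝ, E) ρ (leftVelocity 𝓘(ℝ, E) σ t)
  set b := dRep 𝓘(ℝ, E) ρ (leftVelocity 𝓘(ℝ, E) β t)
  have key : (ρ (γ t) : Matrix (Fin d) (Fin d) ℂ) * dRep 𝓘(ℝ, E) ρ (leftVelocity 𝓘(ℝ, E) γ t) =
      ρ (σ t) * s * ρ (β t) + ρ (σ t) * (ρ (β t) * b) := by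
    ext i j
    refine hu.eq_deriv _ (hasDerivWithinAt_rep_entry hρ hγ ht i j) ?_
    have hprod := HasDerivWithinAt.fun_sum (u := Finset.univ) fun k _ =>
      (hasDerivWithinAt_rep_entry hρ hσ ht i k).mul (hasDerivWithinAt_rep_entry hρ hβ ht k j)
    refine (hprod.congr_of_mem (fun x _ => ?_) ht).congr_deriv ?_
    · rw [h, coe_rep_mul, Matrix.mul_apply]
      rfl
    · rw [Matrix.add_apply, Matrix.mul_apply (N := (ρ (β t)).1), Matrix.mul_apply (M := (ρ (σ t)).1)
        (N := (ρ (β t)).1 * b), Finset.sum_add_distrib]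
  have := congrArg ((ρ (γ t)⁻¹ : Matrix (Fin d) (Fin d) ℂ) * ·) key
  simp only [← mul_assoc, coe_rep_inv_mul, one_mul] at this
  rw [this, h, mul_inv_rev, coe_rep_mul, mul_add]
  congr 1
  · simp only [mul_assoc]
    simp only [← mul_assoc _ _ (s * _), coe_rep_inv_mul, one_mul]
  · simp only [← mul_assoc]
    rw [mul_assoc (ρ (β t)⁻¹).1, coe_rep_inv_mul, mul_one, coe_rep_inv_mul, one_mul]

end Representation

/-! ### Unitarity of the subgroup `K` -/

section Angular

variable {E : Type*} [NormedAddCommGroup E] [NormedSpace ℝ E]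
  {G : Type*} [TopologicalSpace G] [ChartedSpace E G] [Group G]
  {d : ℕ} {ρ : G →* Matrix.SpecialLinearGroup (Fin d) ℂ}
  {LK LP : Submodule ℝ (GroupLieAlgebra 𝓘(ℝ, E) G)}

/-- For an adapted representation, `dρ` carries the decomposition `L = L_P ⊕ L_K` to the
decomposition of a matrix into its Hermitian and skew-Hermitian parts. -/
theorem IsAdaptedRep.exists_hermitian_add_skewHermitian (hρ : IsAdaptedRep ρ LK LP)
    (hc : IsCompl LP LK) (x : GroupLieAlgebra 𝓘(ℝ, E) G) :
    ∃ w, wᴴ = -w ∧ dRep 𝓘(ℝ, E) ρ x = dRep 𝓘(ℝ, E) ρ (LP.projection LK hc x) + w := by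
  refine ⟨dRep 𝓘(ℝ, E) ρ (x - LP.projection LK hc x), hρ.skewHermitian _ ?_, ?_⟩
  · refine (Submodule.projection_apply_eq_zero_iff hc).1 ?_
    rw [map_sub,
      Submodule.projection_apply_of_mem_left hc (Submodule.projection_apply_mem hc x), sub_self]
  · rw [← dRep_add, add_sub_cancel]

variable [LieGroup 𝓘(ℝ, E) ∞ G]

theorem leftTriv_mulInvariantVectorField (x : GroupLieAlgebra 𝓘(ℝ, E) G) (g : G) :
    leftTriv 𝓘(ℝ, E) g (mulInvariantVectorField (I := 𝓘(ℝ, E)) x g) = x := by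
  have hd : ∀ a p : G, HasMFDerivAt 𝓘(ℝ, E) 𝓘(ℝ, E) (fun h : G => a * h) p
      (mfderiv 𝓘(ℝ, E) 𝓘(ℝ, E) (fun h : G => a * h) p) := fun a p =>
    ((contMDiff_mul_left (I := 𝓘(ℝ, E)) (n := ∞) (a := a)).mdifferentiable
      (by simp) p).hasMFDerivAt
  have hcomp := HasMFDerivAt.comp (1 : G) (hd g⁻¹ (g * 1)) (hd g 1)
  have hid : (fun h : G => g⁻¹ * h) ∘ (fun h : G => g * h) = id := by
    ext h
    simp
  rw [hid] at hcomp
  have huniq := hasMFDerivAt_unique hcomp (hasMFDerivAt_id (I := 𝓘(ℝ, E)) (1 : G))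
  have base : ∀ (p : G) (_ : p = g) (w : E),
      (mfderiv 𝓘(ℝ, E) 𝓘(ℝ, E) (fun h : G => g⁻¹ * h) p w : E) = leftTriv 𝓘(ℝ, E) g w := by
    rintro p rfl w
    rfl
  exact (base (g * 1) (mul_one g) _).symm.trans
    (congrArg (fun f : E →L[ℝ] E => f x) huniq)

/-- Along a one-parameter group `γ` with generator `x` one has `(ρ(γ) ρ(γ)*)' = ρ(γ) (dρ(x) +
dρ(x)*) ρ(γ)*`, which vanishes for a skew-Hermitian generator. -/
theorem rep_mul_conjTranspose_of_isExp
    (hρ : ∀ i j, ContMDiff 𝓘(ℝ, E) 𝓘(ℝ, ℂ) ∞ (fun g : G => (ρ g : Matrix (Fin d) (Fin d) ℂ) i j))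
    {x : GroupLieAlgebra 𝓘(ℝ, E) G} (hx : (dRep 𝓘(ℝ, E) ρ x)ᴴ = -dRep 𝓘(ℝ, E) ρ x)
    {g : G} (hg : IsExp x g) :
    (ρ g : Matrix (Fin d) (Fin d) ℂ) * (ρ g : Matrix (Fin d) (Fin d) ℂ)ᴴ = 1 := by
  obtain ⟨γ, h0, hγ, rfl⟩ := hg
  set X := dRep 𝓘(ℝ, E) ρ x
  have hderiv : ∀ t i j, HasDerivAt (fun t => (ρ (γ t) : Matrix (Fin d) (Fin d) ℂ) i j)
      (((ρ (γ t) : Matrix (Fin d) (Fin d) ℂ) * X) i j) t := by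
    intro t i j
    have h2 := HasMFDerivAt.comp t ((hρ i j).mdifferentiable (by simp) (γ t)).hasMFDerivAt (hγ t)
    have h3 := (hasMFDerivAt_iff_hasFDerivAt (𝕜 := ℝ) (E := ℝ) (E' := ℂ)).1 h2
    have h4 := (hasFDerivAt_iff_hasDerivAt (𝕜 := ℝ) (F := ℂ)).1 h3
    refine h4.congr_deriv ?_
    have h5 := mfderiv_rep_entry hρ (γ t) (mulInvariantVectorField (I := 𝓘(ℝ, E)) x (γ t)) i j
    rw [leftTriv_mulInvariantVectorField] at h5
    rw [← h5]
    exact congrArg (mfderiv 𝓘(ℝ, E) 𝓘(ℝ, ℂ)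
      (fun g : G => (ρ g : Matrix (Fin d) (Fin d) ℂ) i j) (γ t)) (one_smul ℝ _)
  have hconst : ∀ i j t, HasDerivAt (fun t => ((ρ (γ t) : Matrix (Fin d) (Fin d) ℂ) *
      (ρ (γ t) : Matrix (Fin d) (Fin d) ℂ)ᴴ) i j) 0 t := by
    intro i j t
    have hprod := HasDerivAt.fun_sum (u := Finset.univ) fun k _ =>
      (hderiv t i k).mul ((hderiv t j k).star)
    refine hprod.congr_deriv ?_
    rw [Finset.sum_add_distrib]
    have e : (ρ (γ t) : Matrix (Fin d) (Fin d) ℂ) * X * (ρ (γ t) : Matrix (Fin d) (Fin d) ℂ)ᴴ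
        + (ρ (γ t) : Matrix (Fin d) (Fin d) ℂ) *
          ((ρ (γ t) : Matrix (Fin d) (Fin d) ℂ) * X)ᴴ = 0 := by
      rw [Matrix.conjTranspose_mul, hx]
      simp [mul_assoc]
    exact congrFun (congrFun e i) j
  ext i j
  have := is_const_of_deriv_eq_zero (fun t => (hconst i j t).differentiableAt)
    (fun t => (hconst i j t).deriv) 1 0
  rw [this, h0, map_one]
  simp

theorem IsAdaptedRep.rep_mul_conjTranspose (hρ : IsAdaptedRep ρ LK LP) {k : G}
    (hk : k ∈ angularSubgroup LK) :
    (ρ k : Matrix (Fin d) (Fin d) ℂ) * (ρ k : Matrix (Fin d) (Fin d) ℂ)ᴴ = 1 := by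
  induction hk using Subgroup.closure_induction with
  | mem g hg =>
    obtain ⟨z, hz, hg⟩ := hg
    exact rep_mul_conjTranspose_of_isExp hρ.smooth (hρ.skewHermitian z hz) hg
  | one => simp
  | mul a b _ _ ha hb =>
    rw [coe_rep_mul, Matrix.conjTranspose_mul, mul_assoc, ← mul_assoc _ _ (ρ a).1ᴴ, hb, one_mul, ha]
  | inv a _ ha =>
    have h2 : (ρ a⁻¹ : Matrix (Fin d) (Fin d) ℂ) = (ρ a : Matrix (Fin d) (Fin d) ℂ)ᴴ :=
      left_inv_eq_right_inv (coe_rep_inv_mul a) ha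
    rw [h2, Matrix.conjTranspose_conjTranspose]
    exact mul_eq_one_comm.1 ha

theorem IsAdaptedRep.rep_inv (hρ : IsAdaptedRep ρ LK LP) {k : G} (hk : k ∈ angularSubgroup LK) :
    (ρ k⁻¹ : Matrix (Fin d) (Fin d) ℂ) = (ρ k : Matrix (Fin d) (Fin d) ℂ)ᴴ :=
  left_inv_eq_right_inv (coe_rep_inv_mul k) (hρ.rep_mul_conjTranspose hk)

/-- The velocity of a path in `K` is skew-Hermitian, since `K` acts by unitary matrices. -/
theorem IsAdaptedRep.conjTranspose_dRep_leftVelocity (hρ : IsAdaptedRep ρ LK LP) {β : ℝ → G}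
    (hβ : ContMDiffOn 𝓘(ℝ, ℝ) 𝓘(ℝ, E) 1 β (Set.Icc 0 1))
    (hK : ∀ t ∈ Set.Icc (0 : ℝ) 1, β t ∈ angularSubgroup LK) {t : ℝ}
    (ht : t ∈ Set.Icc (0 : ℝ) 1) :
    (dRep 𝓘(ℝ, E) ρ (leftVelocity 𝓘(ℝ, E) β t))ᴴ = -dRep 𝓘(ℝ, E) ρ (leftVelocity 𝓘(ℝ, E) β t) := by
  set b := dRep 𝓘(ℝ, E) ρ (leftVelocity 𝓘(ℝ, E) β t)
  set B := (ρ (β t) : Matrix (Fin d) (Fin d) ℂ)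
  have hu : UniqueDiffWithinAt ℝ (Set.Icc (0 : ℝ) 1) t := uniqueDiffOn_Icc zero_lt_one t ht
  have key : B * b * Bᴴ + B * (B * b)ᴴ = 0 := by
    ext i j
    have hprod := HasDerivWithinAt.fun_sum (u := Finset.univ) fun k _ =>
      (hasDerivWithinAt_rep_entry hρ.smooth hβ ht i k).mul
        (hasDerivWithinAt_rep_entry hρ.smooth hβ ht j k).star
    have hconst : HasDerivWithinAt (fun _ => (1 : Matrix (Fin d) (Fin d) ℂ) i j) 0
        (Set.Icc (0 : ℝ) 1) t := hasDerivWithinAt_const _ _ _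
    have hconst' := hconst.congr_of_mem
      (fun s hs => congrFun (congrFun (hρ.rep_mul_conjTranspose (hK s hs)) i) j) ht
    have := hu.eq_deriv _ hprod hconst'
    rw [Finset.sum_add_distrib] at this
    exact this
  have hB : B * Bᴴ = 1 := hρ.rep_mul_conjTranspose (hK t ht)
  have hB' : Bᴴ * B = 1 := mul_eq_one_comm.1 hB
  have := congrArg (fun M => Bᴴ * M * B) key
  simp only [Matrix.conjTranspose_mul, mul_add, add_mul, ← mul_assoc, hB', one_mul, mul_zero,
    zero_mul] at this
  simp only [mul_assoc, hB', mul_one] at this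
  rw [eq_neg_iff_add_eq_zero, add_comm]
  exact this

end Angular

/-! ### Comparison of lengths -/

section Lengths

variable {E : Type*} [NormedAddCommGroup E] [NormedSpace ℝ E]
  {G : Type*} [TopologicalSpace G] [ChartedSpace E G] [Group G]
  {d : ℕ} {ρ : G →* Matrix.SpecialLinearGroup (Fin d) ℂ}

theorem plusForm_leftTriv_smul (c : ℝ) (g : G) (v : TangentSpace 𝓘(ℝ, E) g) :
    plusForm 𝓘(ℝ, E) ρ (leftTriv 𝓘(ℝ, E) g (c • v)) =
      c ^ 2 * plusForm 𝓘(ℝ, E) ρ (leftTriv 𝓘(ℝ, E) g v) := by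
  have h : dRep 𝓘(ℝ, E) ρ (leftTriv 𝓘(ℝ, E) g (c • v)) =
      (c : ℂ) • dRep 𝓘(ℝ, E) ρ (leftTriv 𝓘(ℝ, E) g v) := by
    have h1 : leftTriv 𝓘(ℝ, E) g (c • v) = c • leftTriv 𝓘(ℝ, E) g v :=
      (mfderiv 𝓘(ℝ, E) 𝓘(ℝ, E) (fun h : G => g⁻¹ * h) g).map_smul c v
    rw [h1]
    ext i j
    refine ((mfderiv 𝓘(ℝ, E) 𝓘(ℝ, ℂ) (fun g : G => (ρ g : Matrix (Fin d) (Fin d) ℂ) i j) 1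
      ).map_smul c (leftTriv 𝓘(ℝ, E) g v)).trans ?_
    exact Complex.real_smul
  rw [plusForm, plusForm, h, Matrix.conjTranspose_smul, Matrix.smul_mul, Matrix.mul_smul,
    Matrix.trace_smul, Matrix.trace_smul, Complex.star_def, Complex.conj_ofReal, smul_smul,
    ← Complex.ofReal_mul, smul_eq_mul, Complex.re_ofReal_mul, sq]

theorem distG_le_lintegral {γ : ℝ → G}
    (hγ : ContMDiffOn 𝓘(ℝ, ℝ) 𝓘(ℝ, E) 1 γ (Set.Icc 0 1)) :
    distG 𝓘(ℝ, E) ρ (γ 0) (γ 1) ≤ ∫⁻ t in Set.Icc (0 : ℝ) 1,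
      ENNReal.ofReal √(plusForm 𝓘(ℝ, E) ρ (leftVelocity 𝓘(ℝ, E) γ t)) := by
  let _ : ∀ x : G, ENorm (TangentSpace 𝓘(ℝ, E) x) :=
    fun x => ⟨fun v => ENNReal.ofReal √(plusForm 𝓘(ℝ, E) ρ (leftTriv 𝓘(ℝ, E) x v))⟩
  -- the length of a path is invariant under reparametrization because `√⟨·,·⟩₊` is homogeneous
  have _ : ∀ x : G, ENormSMulClass ℝ (TangentSpace 𝓘(ℝ, E) x) := fun x => ⟨fun c v => by
    change ENNReal.ofReal √_ = _ * ENNReal.ofReal √_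
    rw [plusForm_leftTriv_smul, Real.sqrt_mul (sq_nonneg c), Real.sqrt_sq_eq_abs,
      ENNReal.ofReal_mul (abs_nonneg c), Real.enorm_eq_ofReal_abs]⟩
  refine (Manifold.riemannianEDist_le_pathELength hγ rfl rfl zero_le_one).trans_eq ?_
  exact Manifold.pathELength_eq_lintegral_mfderivWithin_Icc

theorem exists_path_of_distG_lt {g h : G} {r : ℝ≥0∞} (hr : distG 𝓘(ℝ, E) ρ g h < r) :
    ∃ γ : ℝ → G, γ 0 = g ∧ γ 1 = h ∧ ContMDiffOn 𝓘(ℝ, ℝ) 𝓘(ℝ, E) 1 γ (Set.Icc 0 1) ∧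
      ∫⁻ t in Set.Icc (0 : ℝ) 1,
        ENNReal.ofReal √(plusForm 𝓘(ℝ, E) ρ (leftVelocity 𝓘(ℝ, E) γ t)) < r := by
  let _ : ∀ x : G, ENorm (TangentSpace 𝓘(ℝ, E) x) :=
    fun x => ⟨fun v => ENNReal.ofReal √(plusForm 𝓘(ℝ, E) ρ (leftTriv 𝓘(ℝ, E) x v))⟩
  obtain ⟨γ, h0, h1, hγ, hlt⟩ := Manifold.exists_lt_of_riemannianEDist_lt hr
  rw [Manifold.pathELength_eq_lintegral_mfderivWithin_Icc] at hlt
  exact ⟨γ, h0, h1, hγ, hlt⟩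

theorem ofReal_sqrt_le_goldenRatio_mul {a b : ℝ} (h : a ≤ Real.goldenRatio ^ 2 * b) :
    ENNReal.ofReal √a ≤ ENNReal.ofReal Real.goldenRatio * ENNReal.ofReal √b := by
  rw [← ENNReal.ofReal_mul Real.goldenRatio_pos.le]
  refine ENNReal.ofReal_le_ofReal ((Real.sqrt_le_sqrt h).trans_eq ?_)
  rw [Real.sqrt_mul (sq_nonneg _), Real.sqrt_sq Real.goldenRatio_pos.le]

theorem lintegral_le_goldenRatio_mul {f g : ℝ → ℝ}
    (h : ∀ t ∈ Set.Icc (0 : ℝ) 1, f t ≤ Real.goldenRatio ^ 2 * g t) :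
    ∫⁻ t in Set.Icc (0 : ℝ) 1, ENNReal.ofReal √(f t) ≤
      ENNReal.ofReal Real.goldenRatio * ∫⁻ t in Set.Icc (0 : ℝ) 1, ENNReal.ofReal √(g t) := by
  rw [← MeasureTheory.lintegral_const_mul' _ _ ENNReal.ofReal_ne_top]
  exact MeasureTheory.setLIntegral_mono' measurableSet_Icc
    fun t ht => ofReal_sqrt_le_goldenRatio_mul (h t ht)

theorem IsNonTimelike.minusForm_leftVelocity_nonneg {K : Subgroup G} {μ : G ⧸ K → G}
    (hμ : IsSmoothSection K 𝓘(ℝ, E) μ) (hμ' : IsNonTimelike ρ K 𝓘(ℝ, E) μ) {α : ℝ → G}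
    (hα : ContMDiffOn 𝓘(ℝ, ℝ) 𝓘(ℝ, E) 1 α (Set.Icc 0 1)) {t : ℝ} (ht : t ∈ Set.Icc (0 : ℝ) 1) :
    0 ≤ minusForm 𝓘(ℝ, E) ρ (leftVelocity 𝓘(ℝ, E) (fun t => μ (α t : G ⧸ K)) t) := by
  have hcomp := mfderiv_comp_mfderivWithin t (hμ.smooth.mdifferentiable (by simp) (α t))
    (hα.mdifferentiableOn (by simp) t ht)
    (uniqueMDiffWithinAt_iff_uniqueDiffWithinAt.2 (uniqueDiffOn_Icc zero_lt_one t ht))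
  have h := hμ' (α t) (mfderivWithin 𝓘(ℝ, ℝ) 𝓘(ℝ, E) α (Set.Icc 0 1) t (1 : ℝ))
  have hv := congrArg (fun f : ℝ →L[ℝ] E => f 1) hcomp
  have e : leftVelocity 𝓘(ℝ, E) (fun t => μ (α t : G ⧸ K)) t =
      leftTriv 𝓘(ℝ, E) (μ (α t : G ⧸ K)) (mfderiv 𝓘(ℝ, E) 𝓘(ℝ, E) (fun h : G => μ (h : G ⧸ K))
        (α t) (mfderivWithin 𝓘(ℝ, ℝ) 𝓘(ℝ, E) α (Set.Icc 0 1) t (1 : ℝ))) :=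
    congrArg (leftTriv 𝓘(ℝ, E) (μ (α t : G ⧸ K))) hv
  rw [e]
  exact h

variable [LieGroup 𝓘(ℝ, E) ∞ G] {LK LP : Submodule ℝ (GroupLieAlgebra 𝓘(ℝ, E) G)}

/-- Let `α` be a path in `G`, let `σ` be a path with the same projection to `G/K` and non-timelike
velocity, and let `β` be a path in `K`. The speed of `σβ` in `G` and the speed of `(αK, β)` in
`G/K × K` differ at most by the factor `φ`. -/
theorem IsAdaptedRep.plusForm_leftVelocity_bounds (hρ : IsAdaptedRep ρ LK LP) (hc : IsCompl LP LK)
    {α σ β γ : ℝ → G}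
    (hα : ContMDiffOn 𝓘(ℝ, ℝ) 𝓘(ℝ, E) 1 α (Set.Icc 0 1))
    (hσ : ContMDiffOn 𝓘(ℝ, ℝ) 𝓘(ℝ, E) 1 σ (Set.Icc 0 1))
    (hβ : ContMDiffOn 𝓘(ℝ, ℝ) 𝓘(ℝ, E) 1 β (Set.Icc 0 1))
    (hγ : ContMDiffOn 𝓘(ℝ, ℝ) 𝓘(ℝ, E) 1 γ (Set.Icc 0 1))
    (hασ : ∀ t, (α t)⁻¹ * σ t ∈ angularSubgroup LK)
    (hβK : ∀ t ∈ Set.Icc (0 : ℝ) 1, β t ∈ angularSubgroup LK)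
    (hprod : ∀ t, γ t = σ t * β t) {t : ℝ} (ht : t ∈ Set.Icc (0 : ℝ) 1)
    (hmin : 0 ≤ minusForm 𝓘(ℝ, E) ρ (leftVelocity 𝓘(ℝ, E) σ t)) :
    plusForm 𝓘(ℝ, E) ρ (leftVelocity 𝓘(ℝ, E) γ t) ≤ Real.goldenRatio ^ 2 *
        (plusForm 𝓘(ℝ, E) ρ (LP.projection LK hc (leftVelocity 𝓘(ℝ, E) α t)) +
          plusForm 𝓘(ℝ, E) ρ (leftVelocity 𝓘(ℝ, E) β t)) ∧
      plusForm 𝓘(ℝ, E) ρ (LP.projection LK hc (leftVelocity 𝓘(ℝ, E) α t)) +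
          plusForm 𝓘(ℝ, E) ρ (leftVelocity 𝓘(ℝ, E) β t) ≤
        Real.goldenRatio ^ 2 * plusForm 𝓘(ℝ, E) ρ (leftVelocity 𝓘(ℝ, E) γ t) := by
  have hκ : ContMDiffOn 𝓘(ℝ, ℝ) 𝓘(ℝ, E) 1 (fun t => (α t)⁻¹ * σ t) (Set.Icc 0 1) := hα.inv.mul hσ
  obtain ⟨w, hw, hαw⟩ :=
    hρ.exists_hermitian_add_skewHermitian hc (leftVelocity 𝓘(ℝ, E) α t)
  have hh := hρ.hermitian _
    (Submodule.projection_apply_mem hc (leftVelocity 𝓘(ℝ, E) α t))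
  have hu := hρ.conjTranspose_dRep_leftVelocity hκ (fun t _ => hασ t) ht
  have hb := hρ.conjTranspose_dRep_leftVelocity hβ hβK ht
  have hσe := dRep_leftVelocity_mul hρ.smooth hα hκ hσ (fun t => (mul_inv_cancel_left _ _).symm) ht
  have hγe := dRep_leftVelocity_mul hρ.smooth hσ hβ hγ hprod ht
  rw [hρ.rep_inv (hασ t), hαw] at hσe
  rw [hρ.rep_inv (hβK t ht)] at hγe
  have hU := hρ.rep_mul_conjTranspose (hασ t)
  set U := (ρ ((α t)⁻¹ * σ t) : Matrix (Fin d) (Fin d) ℂ)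
  set u := dRep 𝓘(ℝ, E) ρ (leftVelocity 𝓘(ℝ, E) (fun t => (α t)⁻¹ * σ t) t)
  set h := dRep 𝓘(ℝ, E) ρ (LP.projection LK hc (leftVelocity 𝓘(ℝ, E) α t))
  have hσe' : dRep 𝓘(ℝ, E) ρ (leftVelocity 𝓘(ℝ, E) σ t) = Uᴴ * h * U + (Uᴴ * w * U + u) := by
    rw [hσe, mul_add, add_mul, add_assoc]
  have e1 : (Uᴴ * h * U)ᴴ = Uᴴ * h * U := by
    simp [Matrix.conjTranspose_mul, hh, mul_assoc]
  have e2 : (Uᴴ * w * U + u)ᴴ = -(Uᴴ * w * U + u) := by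
    simp [Matrix.conjTranspose_mul, hw, hu, mul_assoc, add_comm]
  rw [minusForm, hσe'] at hmin
  have hest := velocity_estimate (hρ.rep_mul_conjTranspose (hβK t ht)) e1 e2 hb hmin
  rw [← hσe', ← hγe, re_trace_mul_conjTranspose_eq_norm_sq (Uᴴ * h * U),
    norm_conjTranspose_mul_mul_of_unitary hU, ← re_trace_mul_conjTranspose_eq_norm_sq h] at hest
  exact hest

end Lengths

/-- A section of `G → G/K` identifies `G/K × K` with `G`. -/
def sectionMulEquiv {G : Type*} [Group G] (K : Subgroup G) (μ : G ⧸ K → G)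
    (hμ : ∀ p : G ⧸ K, ((μ p : G) : G ⧸ K) = p) : (G ⧸ K) × K ≃ G where
  toFun a := μ a.1 * (a.2 : G)
  invFun g := ((g : G ⧸ K), ⟨(μ (g : G ⧸ K))⁻¹ * g, QuotientGroup.eq.1 (hμ g)⟩)
  left_inv := by
    rintro ⟨p, k⟩
    have h : ((μ p * (k : G) : G) : G ⧸ K) = p := by
      rw [QuotientGroup.mk_mul_of_mem _ k.2, hμ]
    ext
    · exact h
    · simp [h]
  right_inv g := by simp

end CartanBilip

open CartanBilip in
theorem mainTheorem7
    {E : Type*} [NormedAddCommGroup E] [NormedSpace ℝ E] [FiniteDimensional ℝ E] [CompleteSpace E]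
    {G : Type*} [TopologicalSpace G] [T2Space G] [ConnectedSpace G] [ChartedSpace E G] [Group G]
    [LieGroup 𝓘(ℝ, E) ∞ G]
    [LieAlgebra.IsSemisimple ℝ (GroupLieAlgebra 𝓘(ℝ, E) G)]
    (LK : LieSubalgebra ℝ (GroupLieAlgebra 𝓘(ℝ, E) G))
    (LP : Submodule ℝ (GroupLieAlgebra 𝓘(ℝ, E) G))
    (hL : IsCartanDecomposition LK LP)
    {d : ℕ} (ρ : G →* Matrix.SpecialLinearGroup (Fin d) ℂ)
    (hρ : IsAdaptedRep ρ LK.toSubmodule LP)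
    (μ : G ⧸ angularSubgroup LK.toSubmodule → G)
    (hμ : IsSmoothSection (angularSubgroup LK.toSubmodule) 𝓘(ℝ, E) μ)
    (hμ' : IsNonTimelike ρ (angularSubgroup LK.toSubmodule) 𝓘(ℝ, E) μ) :
    ∃ e : (G ⧸ angularSubgroup LK.toSubmodule) × angularSubgroup LK.toSubmodule ≃ G,
      (∀ p k, e (p, k) = μ p * (k : G)) ∧
      (∀ a b, distG 𝓘(ℝ, E) ρ (e a) (e b)
        ≤ ENNReal.ofReal Real.goldenRatio * distPK ρ hL.isCompl a b) ∧
      (∀ g h, distPK ρ hL.isCompl (e.symm g) (e.symm h)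
        ≤ ENNReal.ofReal Real.goldenRatio * distG 𝓘(ℝ, E) ρ g h) := by
  have hφ0 : ENNReal.ofReal Real.goldenRatio ≠ 0 := by
    simpa using Real.goldenRatio_pos
  have hcomp : ∀ {α : ℝ → G}, ContMDiffOn 𝓘(ℝ, ℝ) 𝓘(ℝ, E) 1 α (Set.Icc 0 1) →
      ContMDiffOn 𝓘(ℝ, ℝ) 𝓘(ℝ, E) 1
        (fun t => μ (α t : G ⧸ angularSubgroup LK.toSubmodule)) (Set.Icc 0 1) := fun hα =>
    (hμ.smooth.of_le (by simp)).comp_contMDiffOn hα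
  have hinv_mul_mem : ∀ g : G, g⁻¹ * μ (g : G ⧸ angularSubgroup LK.toSubmodule) ∈
      angularSubgroup LK.toSubmodule := fun g => QuotientGroup.eq.1 (hμ.section_eq g).symm
  refine ⟨sectionMulEquiv _ μ hμ.section_eq, fun p k => rfl, fun a b => ?_, fun g h => ?_⟩
  -- a path `(αK, β)` in `G/K × K` is mapped to the path `μ(αK) β` in `G`
  · simp only [distPK, ENNReal.mul_iInf_of_ne hφ0 ENNReal.ofReal_ne_top]
    refine le_iInf fun α => le_iInf fun β => le_iInf fun hα => le_iInf fun hβ => le_iInf fun hβK =>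
      le_iInf fun h0 => le_iInf fun h1 => ?_
    have hγ : ContMDiffOn 𝓘(ℝ, ℝ) 𝓘(ℝ, E) 1
        (fun t => μ (α t : G ⧸ angularSubgroup LK.toSubmodule) * β t) (Set.Icc 0 1) :=
      (hcomp hα).mul hβ
    have e0 : sectionMulEquiv _ μ hμ.section_eq a =
        μ (α 0 : G ⧸ angularSubgroup LK.toSubmodule) * β 0 := by
      rw [h0.1, h0.2]; rfl
    have e1 : sectionMulEquiv _ μ hμ.section_eq b =
        μ (α 1 : G ⧸ angularSubgroup LK.toSubmodule) * β 1 := by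
      rw [h1.1, h1.2]; rfl
    rw [e0, e1]
    refine (distG_le_lintegral hγ).trans (lintegral_le_goldenRatio_mul fun t ht => ?_)
    exact (hρ.plusForm_leftVelocity_bounds hL.isCompl hα (hcomp hα) hβ hγ
      (fun t => hinv_mul_mem (α t)) hβK (fun _ => rfl) ht
      (hμ'.minusForm_leftVelocity_nonneg hμ hα ht)).1
  -- a path `γ` in `G` is mapped to the path `(γK, μ(γK)⁻¹ γ)` in `G/K × K`
  · rw [← ENNReal.div_le_iff' hφ0 ENNReal.ofReal_ne_top]
    refine le_of_forall_gt_imp_ge_of_dense fun r hr => ?_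
    obtain ⟨γ, rfl, rfl, hγ, hlt⟩ := exists_path_of_distG_lt hr
    rw [ENNReal.div_le_iff' hφ0 ENNReal.ofReal_ne_top]
    have hβ : ContMDiffOn 𝓘(ℝ, ℝ) 𝓘(ℝ, E) 1
        (fun t => (μ (γ t : G ⧸ angularSubgroup LK.toSubmodule))⁻¹ * γ t) (Set.Icc 0 1) :=
      (hcomp hγ).inv.mul hγ
    have hβK : ∀ t ∈ Set.Icc (0 : ℝ) 1,
        (μ (γ t : G ⧸ angularSubgroup LK.toSubmodule))⁻¹ * γ t ∈
          angularSubgroup LK.toSubmodule := fun t _ => QuotientGroup.eq.1 (hμ.section_eq (γ t))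
    have hle : distPK ρ hL.isCompl ((sectionMulEquiv _ μ hμ.section_eq).symm (γ 0))
        ((sectionMulEquiv _ μ hμ.section_eq).symm (γ 1)) ≤ _ :=
      iInf_le_of_le γ <| iInf_le_of_le _ <| iInf_le_of_le hγ <| iInf_le_of_le hβ <|
        iInf_le_of_le hβK <| iInf_le_of_le ⟨rfl, rfl⟩ <| iInf_le_of_le ⟨rfl, rfl⟩ le_rfl
    refine hle.trans ((lintegral_le_goldenRatio_mul fun t ht => ?_).trans
      (mul_le_mul_right hlt.le _))
    exact (hρ.plusForm_leftVelocity_bounds hL.isCompl hγ (hcomp hγ) hβ hγ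
      (fun t => hinv_mul_mem (γ t)) hβK (fun _ => (mul_inv_cancel_left _ _).symm) ht
      (hμ'.minusForm_leftVelocity_nonneg hμ hγ ht)).2
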